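/- Let $f=(f_1,f_2):\mathbb{R}^2\to\mathbb{R}^2$ be a (global) symplectomorphism, i.e. a $C^\infty$ diffeomorphism of $\mathbb{R}^2$ onto itself with $f^*\omega=\omega$ for the standard symplectic form $\omega=dx\wedge dy$. Let $Jf$ be its Jacobian matrix and let $$\|Jf\|=\Big(\sum_{i=1}^{2}\Big(\Big(\frac{\partial f_i}{\partial x}\Big)^2+\Big(\frac{\partial f_i}{\partial y}\Big)^2\Big)\Big)^{1/2}$$ be its Euclidean (Frobenius) norm. If $\|Jf\|$ is a constant function on $\mathbb{R}^2$, then $f$ is an affine map. -/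

import Mathlib

open scoped ContDiff

attribute [local instance] Matrix.frobeniusNormedAddCommGroup

/-- The plane `ℝ²` with its Euclidean structure. -/
abbrev Plane : Type := EuclideanSpace ℝ (Fin 2)

/-- The standard symplectic (area) form `dx ∧ dy` on `ℝ²`. -/
def areaForm (v w : Plane) : ℝ := v 0 * w 1 - v 1 * w 0

/-- A symplectomorphism of `ℝ²`: a smooth diffeomorphism of the whole plane onto itself that
pulls back the standard symplectic form to itself. -/
structure IsSymplectomorphism (f : Plane → Plane) : Prop where
  smooth : ContDiff ℝ ∞ f
  exists_smooth_inverse : ∃ g : Plane → Plane,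
    ContDiff ℝ ∞ g ∧ Function.LeftInverse g f ∧ Function.RightInverse g f
  preserves_form : ∀ x v w : Plane,
    areaForm (fderiv ℝ f x v) (fderiv ℝ f x w) = areaForm v w

/-- The Jacobian matrix of `f` at `x`: its `(i, j)` entry is the partial derivative in the
`j`-th coordinate direction of the `i`-th component of `f`. -/
noncomputable def jacobianMatrix (f : Plane → Plane) (x : Plane) : Matrix (Fin 2) (Fin 2) ℝ :=
  Matrix.of fun i j => (fderiv ℝ f x (EuclideanSpace.single j 1)) i

/-! Identify the plane with ℂ. The moduli of the Wirtinger derivatives `p`, `q` are determined by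
the Jacobian determinant (here 1) and the Frobenius norm, so they are constants `a > b`; only the
arguments `α`, `β` can vary. Equality of mixed derivatives, `∂p/∂z̄ = ∂q/∂z`, read in the frame `e =
exp (iφ)`, `ie` with `φ = (β - α) / 2` (the principal stretch directions if `b > 0`), says that `aα
- bβ` is constant along `e` and `aα + bβ` along `ie`. The normal derivative of `φ` then satisfies
the Riccati equation `κ' = -κ²` along integral curves of `e`. These curves exist for all time,
whereas a nonzero solution blows up, so `κ = 0` (`fderiv_eq_zero_of_transport`). The same holds for
`ie`, hence `α` and `β` are constant. -/

/-! ### Smooth arguments of functions of constant modulus -/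

/-- The second derivative of a smooth map is symmetric. -/
theorem ContDiff.isSymmSndFDerivAt_of_infty {E F : Type*} [NormedAddCommGroup E] [NormedSpace ℝ E]
    [NormedAddCommGroup F] [NormedSpace ℝ F] {f : E → F} (hf : ContDiff ℝ ∞ f) (x : E) :
    IsSymmSndFDerivAt ℝ f x :=
  hf.contDiffAt.isSymmSndFDerivAt (by
    rw [minSmoothness_of_isRCLikeNormedField]
    exact WithTop.coe_le_coe.2 le_top)

open Complex in
/-- A smooth complex function of constant modulus `r > 0` has a smooth argument. -/
theorem exists_contDiff_argument {E : Type*} [NormedAddCommGroup E] [NormedSpace ℝ E]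
    {g : E → ℂ} (hg : ContDiff ℝ ∞ g) {r : ℝ} (hr : 0 < r) (hgr : ∀ x, ‖g x‖ = r) :
    ∃ θ : E → ℝ, ContDiff ℝ ∞ θ ∧ ∀ x, g x = r * cexp (θ x * I) := by
  have hg0 : ∀ x, g x ≠ 0 := fun x h ↦ hr.ne' (by rw [← hgr x, h, norm_zero])
  have hgd : Differentiable ℝ g := hg.differentiable (by simp)
  have hg' : ContDiff ℝ ∞ (fderiv ℝ g) := (contDiff_infty_iff_fderiv.1 hg).2
  have hgd' : Differentiable ℝ (fderiv ℝ g) := hg'.differentiable (by simp)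
  -- The logarithmic derivative is a closed form, so the Poincaré lemma gives a global logarithm `L`
  -- up to a constant.
  set η : E → E →L[ℝ] ℂ := fun x ↦ (g x)⁻¹ • fderiv ℝ g x with hη
  have hηc : ContDiff ℝ ∞ η := (hg.inv hg0).smul hg'
  obtain ⟨L, hL⟩ : ∃ L : E → ℂ, ∀ x ∈ Set.univ, HasFDerivAt L (η x) x := by
    refine convex_univ.exists_forall_hasFDerivAt_of_fderiv_symmetric isOpen_univ
      (hηc.differentiable (by simp)).differentiableOn fun x _ v w ↦ ?_
    have hinv : HasFDerivAt (fun x ↦ (g x)⁻¹) (-((g x) ^ 2)⁻¹ • fderiv ℝ g x) x :=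
      (hasDerivAt_inv (hg0 x)).comp_hasFDerivAt_of_eq x (hgd x).hasFDerivAt rfl
    have hsymm : IsSymmSndFDerivAt ℝ g x :=
      hg.isSymmSndFDerivAt_of_infty x
    have hηx : HasFDerivAt η _ x := hinv.smul (hgd' x).hasFDerivAt
    rw [hηx.fderiv]
    have := hsymm v w
    simp [this]
    ring
  have hLd : ∀ x, HasFDerivAt L (η x) x := fun x ↦ hL x trivial
  have hLc : ContDiff ℝ ∞ L := by
    refine contDiff_infty_iff_fderiv.2 ⟨fun x ↦ (hLd x).differentiableAt, ?_⟩
    rwa [show fderiv ℝ L = η from funext fun x ↦ (hLd x).fderiv]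
  have hconst : ∀ x, g x * cexp (-L x) = g 0 * cexp (-L 0) := by
    have hder : ∀ x, HasFDerivAt (fun x ↦ g x * cexp (-L x)) (0 : E →L[ℝ] ℂ) x := fun x ↦ by
      refine ((hgd x).hasFDerivAt.mul (hLd x).neg.cexp).congr_fderiv ?_
      ext v
      simp [hη]
      field_simp [hg0 x]
      ring
    exact fun x ↦ is_const_of_fderiv_eq_zero (𝕜 := ℝ) (fun x ↦ (hder x).differentiableAt)
      (fun x ↦ (hder x).fderiv) x 0
  set C := g 0 * cexp (-L 0) with hC
  have hC0 : C ≠ 0 := mul_ne_zero (hg0 0) (exp_ne_zero _)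
  have hexp : ∀ x, g x = cexp (L x + log C) := fun x ↦ by
    rw [exp_add, exp_log hC0, ← hconst x, mul_comm, mul_assoc, ← exp_add]
    simp
  refine ⟨fun x ↦ (L x + log C).im, imCLM.contDiff.comp (hLc.add contDiff_const), fun x ↦ ?_⟩
  have h := hgr x
  rw [hexp, norm_exp] at h
  rw [hexp x, ← h, ofReal_exp, ← exp_add, re_add_im]

/-! ### Riccati blow-up along integral curves -/

/-- A solution of `q' = -q²` on `[0, T]` cannot start too far below zero. -/
theorem riccati_initial_value_mul_gt {q : ℝ → ℝ} {T : ℝ} (hT : 0 ≤ T)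
    (hq : ∀ t ∈ Set.Icc 0 T, HasDerivWithinAt q (-(q t) ^ 2) (Set.Icc 0 T) t) :
    -1 < q 0 * T := by
  rcases hT.eq_or_lt with rfl | hT0
  · simp
  rcases le_or_gt 0 (q 0) with h0 | h0
  · nlinarith [mul_nonneg h0 hT]
  have h0T : (0 : ℝ) ∈ Set.Icc 0 T := ⟨le_rfl, hT⟩
  have hanti : AntitoneOn q (Set.Icc 0 T) := by
    refine antitoneOn_of_hasDerivWithinAt_nonpos (convex_Icc 0 T)
      (fun t ht ↦ (hq t ht).continuousWithinAt)
      (fun t ht ↦ (hq t (interior_subset ht)).mono interior_subset)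
      fun t _ ↦ by nlinarith [sq_nonneg (q t)]
  have hneg : ∀ t ∈ Set.Icc 0 T, q t < 0 := fun t ht ↦ (hanti h0T ht ht.1).trans_lt h0
  -- While `q < 0`, the reciprocal grows at unit rate; it must still be negative at time `T`.
  have hder : ∀ t ∈ Set.Icc 0 T,
      HasDerivWithinAt (fun t ↦ (q t)⁻¹ - t) 0 (Set.Icc 0 T) t := fun t ht ↦ by
    have hne : q t ≠ 0 := (hneg t ht).ne
    refine (((hq t ht).inv hne).sub (hasDerivWithinAt_id t _)).congr_deriv ?_
    rw [neg_neg, div_self (pow_ne_zero 2 hne), sub_self]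
  have hT' : T ∈ Set.Icc 0 T := ⟨hT, le_rfl⟩
  have hc := (convex_Icc 0 T).is_const_of_fderivWithin_eq_zero (𝕜 := ℝ)
    (fun t ht ↦ (hder t ht).differentiableWithinAt) (fun t ht ↦ by
      rw [(hder t ht).hasFDerivWithinAt.fderivWithin (uniqueDiffOn_Icc hT0 t ht)]
      ext; simp) hT' h0T
  have h1 := inv_lt_zero.2 (hneg T hT')
  have h2 : T < -(q 0)⁻¹ := by simp only [sub_zero] at hc; linarith
  have h3 := mul_lt_mul_of_neg_left h2 h0
  rwa [mul_neg, mul_inv_cancel₀ h0.ne] at h3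

/-- A bounded `C¹` vector field has integral curves on arbitrarily long time intervals. -/
theorem exists_integralCurve_of_norm_le_one {E : Type*} [NormedAddCommGroup E] [NormedSpace ℝ E]
    [ProperSpace E] {V : E → E} (hV : ContDiff ℝ 1 V) (hb : ∀ x, ‖V x‖ ≤ 1) (x₀ : E) {T : ℝ}
    (hT : 0 ≤ T) :
    ∃ γ : ℝ → E, γ 0 = x₀ ∧
      ∀ t ∈ Set.Icc (-T) T, HasDerivWithinAt γ (V (γ t)) (Set.Icc (-T) T) t := by
  -- At speed at most 1 a curve stays in the ball of radius `T` up to time `T`, so a Lipschitz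
  -- constant there suffices.
  obtain ⟨K, hK⟩ := LocallyLipschitzOn.exists_lipschitzOnWith_of_compact
    (isCompact_closedBall x₀ T) (hV.locallyLipschitz.locallyLipschitzOn (s := _))
  have hPL : IsPicardLindelof (fun _ ↦ V) (tmin := -T) (tmax := T)
      ⟨0, by simpa using hT, hT⟩ x₀ ⟨T, hT⟩ 0 1 K :=
    .of_time_independent (fun x _ ↦ by simpa using hb x) hK (by simp; exact le_rfl)
  exact hPL.exists_eq_forall_mem_Icc_hasDerivWithinAt₀

open Complex in
/-- If `u` is constant along the unit field `e = exp (iφ)` and the derivative of `φ` in the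
normal direction `ie` is a nonzero multiple of that of `u`, then `u` is constant. -/
theorem fderiv_eq_zero_of_transport {u φ : ℂ → ℝ} (hu : ContDiff ℝ ∞ u) (hφ : ContDiff ℝ ∞ φ)
    {k : ℝ} (hk : k ≠ 0) (htan : ∀ z, fderiv ℝ u z (cexp (φ z * I)) = 0)
    (hnor : ∀ z, fderiv ℝ φ z (I * cexp (φ z * I)) = k * fderiv ℝ u z (I * cexp (φ z * I)))
    (z : ℂ) : fderiv ℝ u z = 0 := by
  set e : ℂ → ℂ := fun z ↦ cexp (φ z * I) with he
  have hec : ContDiff ℝ ∞ e := ((ofRealCLM.contDiff.comp hφ).mul contDiff_const).cexp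
  have hu' : Differentiable ℝ (fderiv ℝ u) :=
    (contDiff_infty_iff_fderiv.1 hu).2.differentiable (by simp)
  have hed : ∀ z, HasFDerivAt e
      ((I * e z) • (ofRealCLM.comp (fderiv ℝ φ z))) z := fun z ↦ by
    have h := ((ofRealCLM.hasFDerivAt.comp z
      (hφ.differentiable (by simp) z).hasFDerivAt).mul_const I).cexp
    refine h.congr_fderiv ?_
    ext v
    simp [he]
    ring
  set q : ℂ → ℝ := fun z ↦ k * fderiv ℝ u z (I * e z) with hq
  have hqd : ∀ z, ∃ q' : ℂ →L[ℝ] ℝ, HasFDerivAt q q' z ∧ q' (e z) = -(q z) ^ 2 := fun z ↦ by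
    have h1 := (((hu' z).hasFDerivAt.clm_apply ((hed z).const_mul I)).const_mul k)
    refine ⟨_, h1, ?_⟩
    have h2 := (hu' z).hasFDerivAt.clm_apply (hed z)
    -- Differentiating `du(e) = 0` in the direction `ie` expresses `D²u(ie, e)` as `-dφ(ie) du(ie)`.
    -- By symmetry this is the derivative of `du(ie)` along `e`, since the term from turning the
    -- frame is a multiple of `du(e) = 0`.
    have h3 : fderiv ℝ (fun z ↦ fderiv ℝ u z (e z)) z = 0 := by
      rw [show (fun z ↦ fderiv ℝ u z (e z)) = fun _ ↦ 0 from funext htan]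
      simp
    rw [h2.fderiv] at h3
    have h4 := DFunLike.congr_fun h3 (I * e z)
    have hsymm : IsSymmSndFDerivAt ℝ u z := hu.isSymmSndFDerivAt_of_infty z
    have hr : ∀ (w : ℂ) (c : ℝ), fderiv ℝ u z (w * c) = c * fderiv ℝ u z w := fun w c ↦ by
      rw [mul_comm, ← real_smul, map_smul, smul_eq_mul]
    have h5 : I * (I * e z * ((fderiv ℝ φ z (e z) : ℝ) : ℂ)) =
        e z * ((-(fderiv ℝ φ z (e z)) : ℝ) : ℂ) := by
      push_cast
      linear_combination e z * (fderiv ℝ φ z (e z) : ℝ) * I_mul_I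
    have h6 := hsymm (I * e z) (e z)
    simp [hr] at h4
    simp [h5, hr, hq]
    rw [← h6]
    have h7 : fderiv ℝ φ z (I * e z) = k * fderiv ℝ u z (I * e z) := hnor z
    rw [h7] at h4
    linear_combination k * h4 - k * fderiv ℝ φ z (e z) * htan z
  have hq0 : ∀ z, q z = 0 := fun z ↦ by
    by_contra hne
    -- The blow-up time. Reversing time and sign preserves the Riccati equation, so either sign of
    -- `q z` is excluded.
    set T := |q z|⁻¹ with hT
    have hT0 : 0 ≤ T := by positivity
    obtain ⟨γ, hγ0, hγ⟩ := exists_integralCurve_of_norm_le_one (hec.of_le (by simp))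
      (fun z ↦ (norm_exp_ofReal_mul_I (φ z)).le) z hT0
    have hder : ∀ t ∈ Set.Icc (-T) T,
        HasDerivWithinAt (fun t ↦ q (γ t)) (-(q (γ t)) ^ 2) (Set.Icc (-T) T) t := fun t ht ↦ by
      obtain ⟨q', hq1, hq2⟩ := hqd (γ t)
      rw [← hq2]
      exact hq1.comp_hasDerivWithinAt t (hγ t ht)
    have hfwd := riccati_initial_value_mul_gt (q := fun t ↦ q (γ t)) hT0 fun t ht ↦
      (hder t ⟨by linarith [ht.1], ht.2⟩).mono (Set.Icc_subset_Icc_left (by linarith))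
    have hbwd := riccati_initial_value_mul_gt (q := fun t ↦ -q (γ (-t))) hT0 fun t ht ↦ by
      have h := (hder (-t) ⟨by linarith [ht.2], by linarith [ht.1]⟩).scomp t
        (hasDerivWithinAt_neg t (Set.Icc 0 T))
        fun s hs ↦ ⟨by linarith [hs.2], by linarith [hs.1, hs.2]⟩
      refine h.neg.congr_deriv ?_
      simp
    simp only [neg_zero, hγ0] at hfwd hbwd
    have habs : |q z| * T = 1 := mul_inv_cancel₀ (abs_ne_zero.2 hne)
    rcases abs_choice (q z) with h | h <;> rw [h] at habs <;> linarith
  have hnz : fderiv ℝ u z (I * e z) = 0 := (mul_eq_zero.1 (hq0 z)).resolve_left hk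
  ext w
  have hez : e z ≠ 0 := exp_ne_zero _
  have hw : w = (w / e z).re • e z + (w / e z).im • (I * e z) := by
    rw [real_smul, real_smul]
    conv_lhs => rw [← div_mul_cancel₀ w hez, ← re_add_im (w / e z)]
    ring
  rw [hw, map_add, map_smul, map_smul, hnz, htan]
  simp

/-! ### Wirtinger derivatives of constant modulus -/

open Complex in
theorem hasFDerivAt_of_eq_mul_exp {p : ℂ → ℂ} {r : ℝ} {θ : ℂ → ℝ} (hθ : Differentiable ℝ θ)
    (hp : ∀ z, p z = r * cexp (θ z * I)) (z : ℂ) :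
    HasFDerivAt p ((p z * I) • ofRealCLM.comp (fderiv ℝ θ z)) z := by
  rw [show p = fun z ↦ (r : ℂ) * cexp (θ z * I) from funext hp]
  refine ((((ofRealCLM.hasFDerivAt.comp z (hθ z).hasFDerivAt).mul_const I).cexp).const_mul
    (r : ℂ)).congr_fderiv ?_
  ext v
  simp
  ring

theorem fderiv_complex_eq_zero {θ : ℂ → ℝ} {z : ℂ} (h1 : fderiv ℝ θ z 1 = 0)
    (hI : fderiv ℝ θ z Complex.I = 0) : fderiv ℝ θ z = 0 := by
  ext w
  have hw : w = w.re • (1 : ℂ) + w.im • Complex.I := by simp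
  rw [hw, map_add, map_smul, map_smul, h1, hI]
  simp

open Complex in
/-- If the Wirtinger derivatives `p = ∂G/∂z`, `q = ∂G/∂z̄` of a plane map have constant moduli
`a > b`, then they are constant. -/
theorem const_of_norm_const_of_compatible {p q : ℂ → ℂ} (hp : ContDiff ℝ ∞ p)
    (hq : ContDiff ℝ ∞ q) {a b : ℝ} (hb : 0 ≤ b) (hab : b < a) (hpa : ∀ z, ‖p z‖ = a)
    (hqb : ∀ z, ‖q z‖ = b)
    (hpq : ∀ z, fderiv ℝ p z 1 + I * fderiv ℝ p z I = fderiv ℝ q z 1 - I * fderiv ℝ q z I)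
    (z : ℂ) : p z = p 0 ∧ q z = q 0 := by
  have ha : 0 < a := hb.trans_lt hab
  obtain ⟨α, hα, hpα⟩ := exists_contDiff_argument hp ha hpa
  have hαd : Differentiable ℝ α := hα.differentiable (by simp)
  have hp' := fun z ↦ (hasFDerivAt_of_eq_mul_exp hαd hpα z).fderiv
  have hp0 : ∀ z, p z ≠ 0 := fun z h ↦ ha.ne' (by rw [← hpa z, h, norm_zero])
  rcases hb.eq_or_lt with rfl | hb
  -- For `b = 0` there is no `β`, but compatibility becomes the Cauchy–Riemann equation for `p`,
  -- which has constant modulus.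
  · have hq0 : q = fun _ ↦ 0 := funext fun z ↦ norm_eq_zero.1 (hqb z)
    have hα0 : ∀ z, fderiv ℝ α z = 0 := fun z ↦ by
      have h := hpq z
      rw [hp', hq0] at h
      have h2 : (p z * I) * ((fderiv ℝ α z 1 : ℝ) + I * (fderiv ℝ α z I : ℝ)) = 0 := by
        simp at h
        linear_combination h
      have h3 := (mul_eq_zero.1 h2).resolve_left (mul_ne_zero (hp0 z) I_ne_zero)
      refine fderiv_complex_eq_zero ?_ ?_
      · simpa using congrArg re h3
      · simpa using congrArg im h3
    have hαc := is_const_of_fderiv_eq_zero hαd hα0 z 0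
    exact ⟨by rw [hpα, hpα 0, hαc], by rw [hq0]⟩
  obtain ⟨β, hβ, hqβ⟩ := exists_contDiff_argument hq hb hqb
  have hβd : Differentiable ℝ β := hβ.differentiable (by simp)
  have hq' := fun z ↦ (hasFDerivAt_of_eq_mul_exp hβd hqβ z).fderiv
  set φ : ℂ → ℝ := fun z ↦ (1 / 2) * (β z - α z) with hφ
  have hφc : ContDiff ℝ ∞ φ := contDiff_const.mul (hβ.sub hα)
  have hφ' : ∀ z w, fderiv ℝ φ z w = (1 / 2) * (fderiv ℝ β z w - fderiv ℝ α z w) := fun z w ↦ by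
    have h : HasFDerivAt φ _ z :=
      ((hβd z).hasFDerivAt.sub (hαd z).hasFDerivAt).const_mul (1 / 2 : ℝ)
    rw [h.fderiv]
    simp
  have hframe : ∀ z, a * fderiv ℝ α z (cexp (φ z * I)) = b * fderiv ℝ β z (cexp (φ z * I)) ∧
      a * fderiv ℝ α z (I * cexp (φ z * I)) = -(b * fderiv ℝ β z (I * cexp (φ z * I))) := fun z ↦ by
    have h := hpq z
    rw [hp', hq', hpα, hqβ] at h
    simp at h
    have hα2 : cexp (α z * I) = cexp ((α z + β z) / 2 * I) * cexp (-φ z * I) := by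
      rw [← exp_add]; congr 1; simp [hφ]; ring
    have hβ2 : cexp (β z * I) = cexp ((α z + β z) / 2 * I) * cexp (φ z * I) := by
      rw [← exp_add]; congr 1; simp [hφ]; ring
    -- Cancelling the common phase leaves `exp (∓iφ)`, whose real and imaginary parts turn the
    -- coordinate derivatives into derivatives along `e` and `ie`.
    have h2 : (cexp ((α z + β z) / 2 * I) * I) *
        (a * cexp (-φ z * I) * ((fderiv ℝ α z 1 : ℝ) + (fderiv ℝ α z I : ℝ) * I) -
          b * cexp (φ z * I) * ((fderiv ℝ β z 1 : ℝ) - (fderiv ℝ β z I : ℝ) * I)) = 0 := by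
      rw [hα2, hβ2] at h
      linear_combination h
    have h3 := (mul_eq_zero.1 h2).resolve_left (mul_ne_zero (exp_ne_zero _) I_ne_zero)
    have hexp : cexp (φ z * I) = Real.cos (φ z) • (1 : ℂ) + Real.sin (φ z) • I := by
      simp [exp_mul_I]
    have hIexp : I * cexp (φ z * I) = (-Real.sin (φ z)) • (1 : ℂ) + Real.cos (φ z) • I := by
      rw [hexp]
      simp
      linear_combination sin (φ z) * I_mul_I
    have hnexp : cexp (-φ z * I) = (Real.cos (φ z) : ℂ) - (Real.sin (φ z) : ℂ) * I := by
      rw [exp_mul_I]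
      simp
      ring
    have hre := congrArg re h3
    have him := congrArg im h3
    rw [hnexp, hexp] at hre him
    simp only [real_smul, add_re, sub_re, mul_re, add_im, sub_im, mul_im, ofReal_re, ofReal_im,
      I_re, I_im, one_re, one_im, zero_re, zero_im] at hre him
    rw [hIexp, hexp]
    simp only [map_add, map_smul, smul_eq_mul]
    constructor
    · linear_combination hre
    · linear_combination him
  have hu' : ∀ z w, fderiv ℝ (fun z ↦ a * α z - b * β z) z w =
      a * fderiv ℝ α z w - b * fderiv ℝ β z w := fun z w ↦ by
    have h : HasFDerivAt (fun z ↦ a * α z - b * β z) _ z :=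
      ((hαd z).hasFDerivAt.const_mul a).sub ((hβd z).hasFDerivAt.const_mul b)
    rw [h.fderiv]
    simp
  have hv' : ∀ z w, fderiv ℝ (fun z ↦ a * α z + b * β z) z w =
      a * fderiv ℝ α z w + b * fderiv ℝ β z w := fun z w ↦ by
    have h : HasFDerivAt (fun z ↦ a * α z + b * β z) _ z :=
      ((hαd z).hasFDerivAt.const_mul a).add ((hβd z).hasFDerivAt.const_mul b)
    rw [h.fderiv]
    simp
  have hu0 := fderiv_eq_zero_of_transport (k := -(a + b) / (4 * a * b))
    ((contDiff_const.mul hα).sub (contDiff_const.mul hβ)) hφc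
    (div_ne_zero (by linarith) (by positivity))
    (fun z ↦ by rw [hu', (hframe z).1, sub_self])
    (fun z ↦ by
      rw [hu', hφ']
      have h := (hframe z).2
      generalize fderiv ℝ α z _ = A at h ⊢
      generalize fderiv ℝ β z _ = B at h ⊢
      field_simp
      linear_combination (2 * (a - b)) * h)
  -- Rotating the frame by a right angle makes `ie` the tangent and `-e` the normal; the new `k` is
  -- nonzero because `a ≠ b`.
  have hrot : ∀ z, cexp ((φ z + Real.pi / 2 : ℝ) * I) = I * cexp (φ z * I) := fun z ↦ by
    push_cast
    rw [add_mul, exp_add, exp_pi_div_two_mul_I, mul_comm]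
  have hII : ∀ w : ℂ, I * (I * w) = -w := fun w ↦ by rw [← mul_assoc, I_mul_I, neg_one_mul]
  have hv0 := fderiv_eq_zero_of_transport (φ := fun z ↦ φ z + Real.pi / 2)
    (k := (a - b) / (4 * a * b))
    ((contDiff_const.mul hα).add (contDiff_const.mul hβ)) (hφc.add contDiff_const)
    (div_ne_zero (by linarith) (by positivity))
    (fun z ↦ by rw [hrot, hv', (hframe z).2, neg_add_cancel])
    (fun z ↦ by
      rw [fderiv_add_const, hrot, hII, map_neg, map_neg, hv', hφ']
      have h := (hframe z).1
      generalize fderiv ℝ α z _ = A at h ⊢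
      generalize fderiv ℝ β z _ = B at h ⊢
      field_simp
      linear_combination (2 * (a + b)) * h)
  have hα0 : ∀ z, fderiv ℝ α z = 0 := fun z ↦ by
    ext w
    have h1 := hu' z w
    have h2 := hv' z w
    rw [hu0] at h1
    rw [hv0] at h2
    simp only [zero_apply] at h1 h2 ⊢
    exact (mul_eq_zero.1 (by linarith : a * fderiv ℝ α z w = 0)).resolve_left ha.ne'
  have hβ0 : ∀ z, fderiv ℝ β z = 0 := fun z ↦ by
    ext w
    have h1 := hu' z w
    have h2 := hv' z w
    rw [hu0] at h1
    rw [hv0] at h2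
    simp only [zero_apply] at h1 h2 ⊢
    exact (mul_eq_zero.1 (by linarith : b * fderiv ℝ β z w = 0)).resolve_left hb.ne'
  have hαc := is_const_of_fderiv_eq_zero hαd hα0 z 0
  have hβc := is_const_of_fderiv_eq_zero hβd hβ0 z 0
  exact ⟨by rw [hpα, hpα 0, hαc], by rw [hqβ, hqβ 0, hβc]⟩

open Complex in
/-- An area-preserving smooth map of the plane whose differential has constant Frobenius norm has
constant differential. -/
theorem fderiv_const_of_areaPreserving {G : ℂ → ℂ} (hG : ContDiff ℝ ∞ G) {C : ℝ}
    (hdet : ∀ z, (fderiv ℝ G z 1).re * (fderiv ℝ G z I).im -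
      (fderiv ℝ G z 1).im * (fderiv ℝ G z I).re = 1)
    (hC : ∀ z, normSq (fderiv ℝ G z 1) + normSq (fderiv ℝ G z I) = C) (z : ℂ) :
    fderiv ℝ G z = fderiv ℝ G 0 := by
  have hG' : ContDiff ℝ ∞ (fderiv ℝ G) := (contDiff_infty_iff_fderiv.1 hG).2
  have hGd' : Differentiable ℝ (fderiv ℝ G) := hG'.differentiable (by simp)
  set p : ℂ → ℂ := fun z ↦ (1 / 2) * (fderiv ℝ G z 1 - I * fderiv ℝ G z I) with hp
  set q : ℂ → ℂ := fun z ↦ (1 / 2) * (fderiv ℝ G z 1 + I * fderiv ℝ G z I) with hq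
  have hpc : ContDiff ℝ ∞ p := contDiff_const.mul ((hG'.clm_apply contDiff_const).sub
    (contDiff_const.mul (hG'.clm_apply contDiff_const)))
  have hqc : ContDiff ℝ ∞ q := contDiff_const.mul ((hG'.clm_apply contDiff_const).add
    (contDiff_const.mul (hG'.clm_apply contDiff_const)))
  have hpn : ∀ z, normSq (p z) = (C + 2) / 4 := fun z ↦ by
    rw [← hC z]
    simp [hp, normSq_apply]
    linear_combination (1 / 2) * hdet z
  have hqn : ∀ z, normSq (q z) = (C - 2) / 4 := fun z ↦ by
    rw [← hC z]
    simp [hq, normSq_apply]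
    linear_combination (-1 / 2) * hdet z
  have hC2 : 0 ≤ (C - 2) / 4 := hqn 0 ▸ normSq_nonneg _
  have hd : ∀ z v, HasFDerivAt (fun z ↦ fderiv ℝ G z v) ((fderiv ℝ (fderiv ℝ G) z).flip v) z :=
    fun z v ↦ by simpa using (hGd' z).hasFDerivAt.clm_apply (hasFDerivAt_const v z)
  have hconst := const_of_norm_const_of_compatible hpc hqc (Real.sqrt_nonneg _)
    (Real.sqrt_lt_sqrt hC2 (by linarith : (C - 2) / 4 < (C + 2) / 4))
    (fun z ↦ by rw [Complex.norm_def, hpn]) (fun z ↦ by rw [Complex.norm_def, hqn]) fun z ↦ by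
      -- Once the mixed terms cancel, both sides equal half the Laplacian of `G`.
      have hsymm := (hG.isSymmSndFDerivAt_of_infty z) 1 I
      have hpd : HasFDerivAt p _ z :=
        ((hd z 1).sub ((hd z I).const_mul I)).const_mul (1 / 2 : ℂ)
      have hqd : HasFDerivAt q _ z :=
        ((hd z 1).add ((hd z I).const_mul I)).const_mul (1 / 2 : ℂ)
      rw [hpd.fderiv, hqd.fderiv]
      simp [hsymm]
      ring
  obtain ⟨h1, h2⟩ := hconst z
  have e1 : fderiv ℝ G z 1 = fderiv ℝ G 0 1 := by
    simp only [hp, hq] at h1 h2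
    linear_combination h1 + h2
  have eI : fderiv ℝ G z I = fderiv ℝ G 0 I := by
    simp only [hp, hq] at h1 h2
    linear_combination I * h1 - I * h2 + (fderiv ℝ G z I - fderiv ℝ G 0 I) * I_mul_I
  ext w
  have hw : w = w.re • (1 : ℂ) + w.im • I := by simp
  rw [hw]
  simp only [map_add, map_smul, e1, eI]

/-! ### From constant differential to affine map -/

/-- A differentiable map with constant derivative is affine. -/
theorem exists_affineMap_of_fderiv_const {E F : Type*} [NormedAddCommGroup E] [NormedSpace ℝ E]
    [NormedAddCommGroup F] [NormedSpace ℝ F] {f : E → F} (hf : Differentiable ℝ f)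
    (h : ∀ x, fderiv ℝ f x = fderiv ℝ f 0) : ∃ g : E →ᵃ[ℝ] F, ∀ x, f x = g x := by
  refine ⟨(fderiv ℝ f 0 : E →ₗ[ℝ] F).toAffineMap + AffineMap.const ℝ E (f 0), fun x ↦ ?_⟩
  have hd : ∀ x, HasFDerivAt (fun x ↦ f x - fderiv ℝ f 0 x) (0 : E →L[ℝ] F) x := fun x ↦
    ((hf x).hasFDerivAt.sub (fderiv ℝ f 0).hasFDerivAt).congr_fderiv (by rw [h x, sub_self])
  have := is_const_of_fderiv_eq_zero (𝕜 := ℝ) (fun x ↦ (hd x).differentiableAt)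
    (fun x ↦ (hd x).fderiv) x 0
  simp only [map_zero, sub_zero] at this
  simp [← this]

theorem mainTheorem11 (f : Plane → Plane) (hf : IsSymplectomorphism f)
    (hJ : ∃ c : ℝ, ∀ x : Plane, ‖jacobianMatrix f x‖ = c) :
    ∃ g : Plane →ᵃ[ℝ] Plane, ∀ x : Plane, f x = g x := by
  obtain ⟨c, hc⟩ := hJ
  have hfd : Differentiable ℝ f := hf.smooth.differentiable (by simp)
  let ι : ℂ ≃L[ℝ] Plane := Complex.orthonormalBasisOneI.repr.toContinuousLinearEquiv
  have hι1 : ι 1 = EuclideanSpace.single 0 1 := by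
    have := Complex.orthonormalBasisOneI.repr_self 0
    simpa [ι] using this
  have hιI : ι Complex.I = EuclideanSpace.single 1 1 := by
    have := Complex.orthonormalBasisOneI.repr_self 1
    simpa [ι] using this
  have hre : ∀ y : Plane, (ι.symm y).re = y 0 := fun y ↦ by
    obtain ⟨w, rfl⟩ := ι.surjective y
    rw [ι.symm_apply_apply]
    simp [ι]
  have him : ∀ y : Plane, (ι.symm y).im = y 1 := fun y ↦ by
    obtain ⟨w, rfl⟩ := ι.surjective y
    rw [ι.symm_apply_apply]
    simp [ι]
  have hG : ContDiff ℝ ∞ (fun z ↦ ι.symm (f (ι z))) :=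
    ι.symm.contDiff.comp (hf.smooth.comp ι.contDiff)
  have hG' : ∀ z w, fderiv ℝ (fun z ↦ ι.symm (f (ι z))) z w = ι.symm (fderiv ℝ f (ι z) (ι w)) :=
    fun z w ↦ by
      have h := ι.symm.hasFDerivAt.comp z ((hfd (ι z)).hasFDerivAt.comp z ι.hasFDerivAt)
      have h' : HasFDerivAt (fun z ↦ ι.symm (f (ι z))) _ z := h
      rw [h'.fderiv]
      rfl
  have hconst := fderiv_const_of_areaPreserving hG (C := c ^ 2)
    (fun z ↦ by
      have h := hf.preserves_form (ι z) (ι 1) (ι Complex.I)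
      rw [hG', hG', hre, hre, him, him]
      rw [areaForm] at h
      rw [h, hι1, hιI]
      simp [areaForm])
    (fun z ↦ by
      rw [hG', hG', Complex.normSq_apply, Complex.normSq_apply, hre, hre, him, him, hι1, hιI,
        ← hc (ι z), Matrix.frobenius_norm_def, ← Real.sqrt_eq_rpow,
        Real.sq_sqrt (by positivity)]
      simp [Fin.sum_univ_two, jacobianMatrix]
      ring)
  refine exists_affineMap_of_fderiv_const hfd fun x ↦ ?_
  ext1 v
  have h := DFunLike.congr_fun (hconst (ι.symm x)) (ι.symm v)
  rw [hG', hG'] at h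
  simpa using h
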